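/- Let $\varrho$ and $\sigma$ be states (density matrices) of a $d$-level system, i.e. on $\mathbb{C}^d$, with eigenvalues $p_1\ge\dots\ge p_d$ and $q_1\ge\dots\ge q_d$ (listed with multiplicity). A noisy operation is a composition of finitely many maps of the following three kinds: unitary conjugations $A\mapsto UAU^\dagger$; additions of a maximally mixed ancilla $A\mapsto A\otimes\tau_N$ with $\tau_N=\mathbf 1/N$ and $N\ge 1$ arbitrary; and partial traces over a tensor factor. Then the transition $\varrho\to\sigma$ is possible by noisy operations to arbitrary precision, meaning that for every $\varepsilon>0$ there is a noisy operation $\Lambda$ from operators on $\mathbb{C}^d$ to operators on $\mathbb{C}^d$ with $\|\Lambda(\varrho)-\sigma\|_1<\varepsilon$ (trace norm: the sum of the singular values), if and only if $\sigma$ is more mixed than $\varrho$, that is, $$\sum_{i=1}^k q_i\le\sum_{i=1}^k p_i\qquad\text{for all } k\le d.$$ -/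

import Mathlib

open scoped Kronecker ComplexOrder

noncomputable section

/-- A state of a `d`-level system: a density matrix on `ℂ^d`. -/
structure DensityMatrix (d : ℕ) where
  mat : Matrix (Fin d) (Fin d) ℂ
  posSemidef : mat.PosSemidef
  trace_eq_one : mat.trace = 1

/-- Operators on `ℂ^n`. -/
abbrev Op (n : ℕ) := Matrix (Fin n) (Fin n) ℂ

/-- The maximally mixed state `τ_N = 1 / N` of an `N`-level system. -/
def maximallyMixed (N : ℕ) : Op N := (N : ℂ)⁻¹ • (1 : Op N)

/-- The unitary operation `A ↦ U A U†`. -/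
def unitaryMap {n : ℕ} (U : Matrix.unitaryGroup (Fin n) ℂ) : Op n →ₗ[ℂ] Op n where
  toFun A := (U : Op n) * A * (U : Op n).conjTranspose
  map_add' A B := by rw [mul_add, add_mul]
  map_smul' c A := by simp

/-- Adding an ancilla of `N` levels in the maximally mixed state, `A ↦ A ⊗ τ_N`. The composite
system has `k = n * N` levels; `e` labels its basis by the product basis. -/
def addNoise {n N k : ℕ} (e : Fin n × Fin N ≃ Fin k) : Op n →ₗ[ℂ] Op k where
  toFun A := Matrix.reindex e e (A ⊗ₖ maximallyMixed N)
  map_add' A B := by rw [Matrix.add_kronecker]; rfl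
  map_smul' c A := by rw [Matrix.smul_kronecker]; rfl

/-- The partial trace over the second tensor factor of `ℂ^k ≅ ℂ^n ⊗ ℂ^N`, the basis of `ℂ^k`
being labelled by the product basis through `e`. -/
def traceOut {n N k : ℕ} (e : Fin n × Fin N ≃ Fin k) : Op k →ₗ[ℂ] Op n where
  toFun A := Matrix.of fun i j => ∑ a : Fin N, A (e (i, a)) (e (j, a))
  map_add' A B := by ext i j; simp [Finset.sum_add_distrib]
  map_smul' c A := by ext i j; simp [Finset.mul_sum]

/-- Noisy operations: the maps obtained by composing finitely many unitary operations, additions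
of maximally mixed ancillas (of any finite dimension) and partial traces (over any tensor
factor). -/
inductive IsNoisyOperation : {m n : ℕ} → (Op m →ₗ[ℂ] Op n) → Prop
  | unitary {n : ℕ} (U : Matrix.unitaryGroup (Fin n) ℂ) : IsNoisyOperation (unitaryMap U)
  | ancilla {n N k : ℕ} (hN : 0 < N) (e : Fin n × Fin N ≃ Fin k) :
      IsNoisyOperation (addNoise e)
  | partialTrace {n N k : ℕ} (hN : 0 < N) (e : Fin n × Fin N ≃ Fin k) :
      IsNoisyOperation (traceOut e)
  | comp {l m n : ℕ} {g : Op m →ₗ[ℂ] Op n} {f : Op l →ₗ[ℂ] Op m} :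
      IsNoisyOperation g → IsNoisyOperation f → IsNoisyOperation (g ∘ₗ f)

/-- The trace norm: the sum of the singular values, that is, of the square roots of the
eigenvalues of `A† A`. -/
def traceNorm {n : ℕ} (A : Op n) : ℝ :=
  ∑ i, √((Matrix.isHermitian_conjTranspose_mul_self A).eigenvalues i)

/-- `ρ` can be transformed into `σ` by noisy operations, to arbitrary precision. -/
def NoisyTransition {d : ℕ} (ρ σ : DensityMatrix d) : Prop :=
  ∀ ε : ℝ, 0 < ε →
    ∃ Λ : Op d →ₗ[ℂ] Op d, IsNoisyOperation Λ ∧ traceNorm (Λ ρ.mat - σ.mat) < ε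

/-- The sum of the `k` largest eigenvalues, with multiplicity, of a state
(`eigenvalues₀` lists the eigenvalues in decreasing order). -/
def DensityMatrix.sumLargest {d : ℕ} (ρ : DensityMatrix d) (k : ℕ) : ℝ :=
  ∑ i : Fin (Fintype.card (Fin d)) with i.val < k,
    ρ.posSemidef.isHermitian.eigenvalues₀ i

/-- `ρ` is more mixed than `ρ'`: every sum of largest eigenvalues of `ρ` is at most the
corresponding sum for `ρ'`. -/
def MoreMixed {d : ℕ} (ρ ρ' : DensityMatrix d) : Prop :=
  ∀ k ≤ d, ρ.sumLargest k ≤ ρ'.sumLargest k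

end

/-! Noisy operations are positive and trace preserving, and in equal dimensions they fix the
identity. Read in eigenbases of ρ and σ, such a map therefore acts on diagonals by a doubly
stochastic matrix, which cannot increase sums of largest entries; approximation costs an error that
tends to 0 (`NoisyTransition.moreMixed`). Conversely, Rado's theorem puts the spectrum of σ in the
convex hull of the permuted spectra of ρ. Uniform averages of permutations are dense there, and each
one is realised exactly by a permutation of the system controlled by a maximally mixed ancilla
(`exists_isNoisyOperation_diagonal`). -/

/-! ### Majorization of real vectors and approximation in convex hulls -/

theorem sum_filter_val_lt_succ {n k : ℕ} (hk : k < n) (x : Fin n → ℝ) :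
    ∑ i with i.val < k + 1, x i = x ⟨k, hk⟩ + ∑ i with i.val < k, x i := by
  have h : (Finset.univ.filter fun i : Fin n => i.val < k + 1) =
      insert ⟨k, hk⟩ (Finset.univ.filter fun i : Fin n => i.val < k) := by
    ext i
    simp [Fin.ext_iff]
    omega
  rw [h, Finset.sum_insert (by simp)]

/-- An average of a decreasing sequence with weights in `[0, 1]` of total weight `k` is at most
the sum of its first `k` terms. -/
theorem sum_mul_le_sum_filter_val_lt {n k : ℕ} {p t : Fin n → ℝ} (hp : Antitone p) (hk : k ≤ n)
    (h0 : ∀ i, 0 ≤ t i) (h1 : ∀ i, t i ≤ 1) (ht : ∑ i, t i = k) :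
    ∑ i, p i * t i ≤ ∑ i with i.val < k, p i := by
  rcases Nat.eq_zero_or_pos k with rfl | hpos
  · have h : ∀ i, t i = 0 := by
      simpa using (Finset.sum_eq_zero_iff_of_nonneg (s := Finset.univ) fun i _ => h0 i).1
        (by simpa using ht)
    simp [h]
  · set c := p ⟨k - 1, by omega⟩
    have hcard : ∑ i : Fin n, (if i.val < k then (1 : ℝ) else 0) = k := by
      simp [Fin.card_filter_val_lt, hk]
    -- The weights and the indicator of the first `k` indices have the same total, so subtracting
    -- the threshold `c` is free and makes every term nonpositive.
    have h : ∑ i, (p i - c) * (t i - if i.val < k then 1 else 0) ≤ 0 := by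
      refine Finset.sum_nonpos fun i _ => ?_
      split_ifs with hi
      · exact mul_nonpos_of_nonneg_of_nonpos
          (sub_nonneg.2 (hp (Fin.le_def.2 (by simp; omega)))) (sub_nonpos.2 (h1 i))
      · exact mul_nonpos_of_nonpos_of_nonneg
          (sub_nonpos.2 (hp (Fin.le_def.2 (by simp; omega)))) (by simpa using h0 i)
    have h' : ∑ i, (p i - c) * (t i - if i.val < k then 1 else 0) =
        ∑ i, p i * t i - ∑ i with i.val < k, p i := by
      rw [Finset.sum_filter]
      simp only [mul_sub, sub_mul, Finset.sum_sub_distrib, ← Finset.mul_sum, ht, hcard]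
      simp
    linarith

/-- Summation by parts: a decreasing weighting of a sequence with nonnegative partial sums. -/
theorem mul_sum_le_sum_mul_of_antitone {n : ℕ} {c x : Fin n → ℝ} (hc : Antitone c)
    (hx : ∀ k ≤ n, 0 ≤ ∑ i with i.val < k, x i) :
    ∀ k (hk : k < n), c ⟨k, hk⟩ * ∑ i with i.val < k + 1, x i ≤
      ∑ i with i.val < k + 1, c i * x i
  | 0, hk => by
    rw [sum_filter_val_lt_succ hk x, sum_filter_val_lt_succ hk fun i => c i * x i]
    simp
  | k + 1, hk => by
    rw [sum_filter_val_lt_succ hk x, sum_filter_val_lt_succ hk fun i => c i * x i, mul_add]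
    have ih := mul_sum_le_sum_mul_of_antitone hc hx k (by omega)
    have hle : c ⟨k + 1, hk⟩ ≤ c ⟨k, by omega⟩ := hc (Fin.le_def.2 (by simp))
    linarith [mul_le_mul_of_nonneg_right hle (hx (k + 1) hk.le)]

theorem sum_mul_le_sum_mul_of_antitone {n : ℕ} {c p q : Fin n → ℝ} (hc : Antitone c)
    (h : ∀ k ≤ n, ∑ i with i.val < k, q i ≤ ∑ i with i.val < k, p i)
    (hs : ∑ i, q i = ∑ i, p i) : ∑ i, c i * q i ≤ ∑ i, c i * p i := by
  rcases n with _ | n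
  · simp
  · have hall : (Finset.univ.filter fun i : Fin (n + 1) => i.val < n + 1) = Finset.univ := by
      ext i; simp; omega
    have := mul_sum_le_sum_mul_of_antitone (x := p - q) hc
      (fun k hk => by simpa [Finset.sum_sub_distrib] using h k hk) n n.lt_succ_self
    rw [hall] at this
    simp only [Pi.sub_apply, mul_sub, Finset.sum_sub_distrib, hs, sub_self] at this
    linarith

/-- **Hardy–Littlewood–Pólya, Rado**: a vector majorized by `p` lies in the convex hull of the
rearrangements of `p`. -/
theorem mem_convexHull_range_comp_perm {n : ℕ} {p q : Fin n → ℝ} (hq : Antitone q)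
    (h : ∀ k ≤ n, ∑ i with i.val < k, q i ≤ ∑ i with i.val < k, p i)
    (hs : ∑ i, q i = ∑ i, p i) :
    q ∈ convexHull ℝ (Set.range fun π : Equiv.Perm (Fin n) => p ∘ π) := by
  by_contra hmem
  obtain ⟨f, u, hlt, hu⟩ := geometric_hahn_banach_closed_point (convex_convexHull ℝ _)
    ((Set.finite_range _).isClosed_convexHull ℝ) hmem
  set c : Fin n → ℝ := fun i => f (Pi.single i 1)
  have hf : ∀ x, f x = ∑ i, c i * x i := fun x => by
    conv_lhs => rw [pi_eq_sum_univ' x, map_sum]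
    refine Finset.sum_congr rfl fun i _ => ?_
    rw [map_smul, smul_eq_mul, mul_comm]
  -- A separating functional `c` is sorted decreasingly. Since `q` is decreasing, this can only
  -- raise its value on `q` (rearrangement); `p ∘ τ.symm` then contradicts the separation.
  set τ := Tuple.sort (-c)
  have hc : Antitone (c ∘ τ) := fun i j hij => by
    simpa using Tuple.monotone_sort (-c) hij
  have h1 : ∑ i, c i * q i ≤ ∑ i, (c ∘ τ) i * q i := by
    rw [← Equiv.sum_comp τ]
    exact (hc.monovary hq).sum_mul_comp_perm_le_sum_mul
  have h2 := sum_mul_le_sum_mul_of_antitone hc h hs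
  have h3 : ∑ i, (c ∘ τ) i * p i = f (p ∘ τ.symm) := by
    rw [hf, ← Equiv.sum_comp τ fun i => c i * (p ∘ τ.symm) i]
    simp
  have h4 := hlt _ (subset_convexHull ℝ _ ⟨τ.symm, rfl⟩)
  rw [hf q] at hu
  linarith

open Filter Topology in
/-- Uniform averages of elements of a set are dense in its convex hull. -/
theorem exists_dist_average_lt {E : Type*} [NormedAddCommGroup E] [NormedSpace ℝ E] {s : Set E}
    {x : E} (hx : x ∈ convexHull ℝ s) {ε : ℝ} (hε : 0 < ε) :
    ∃ (N : ℕ) (_ : 0 < N) (g : Fin N → E), (∀ a, g a ∈ s) ∧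
      dist ((N : ℝ)⁻¹ • ∑ a, g a) x < ε := by
  obtain ⟨ι, _, w, v, hw0, hw1, hv, rfl⟩ := mem_convexHull_iff_exists_fintype.1 hx
  -- The weights are approximated by rationals `⌊w i * n⌋₊ / n`, renormalised because rounding down
  -- may lose mass. Repeating `v i` that many times gives a uniform average.
  have hfl : ∀ i, Tendsto (fun n : ℕ => (⌊w i * n⌋₊ : ℝ) / n) atTop (𝓝 (w i)) := fun i =>
    (tendsto_nat_floor_mul_div_atTop (hw0 i)).comp tendsto_natCast_atTop_atTop
  have hN : Tendsto (fun n : ℕ => ∑ i, (⌊w i * n⌋₊ : ℝ) / n) atTop (𝓝 1) :=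
    hw1 ▸ tendsto_finsetSum _ fun i _ => hfl i
  have hlim : Tendsto (fun n : ℕ => (∑ i, (⌊w i * n⌋₊ : ℝ) / n)⁻¹ •
      ∑ i, ((⌊w i * n⌋₊ : ℝ) / n) • v i) atTop (𝓝 (∑ i, w i • v i)) := by
    simpa using (hN.inv₀ one_ne_zero).smul
      (tendsto_finsetSum Finset.univ fun i _ => (hfl i).smul_const (v i))
  obtain ⟨n, hn, hpos, hn0⟩ := ((Metric.tendsto_nhds.1 hlim ε hε).and
    ((hN.eventually (lt_mem_nhds one_pos)).and (eventually_gt_atTop 0))).exists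
  have hn0' : (n : ℝ) ≠ 0 := by positivity
  let m : ι → ℕ := fun i => ⌊w i * n⌋₊
  let e : Fin (∑ i, m i) ≃ Σ i, Fin (m i) := (Fintype.equivFinOfCardEq (by simp)).symm
  have hsum : ∑ a, v (e a).1 = ∑ i, (m i : ℝ) • v i := by
    rw [Equiv.sum_comp e fun s => v s.1, Fintype.sum_sigma]
    simp [Nat.cast_smul_eq_nsmul]
  refine ⟨∑ i, m i, ?_, fun a => v (e a).1, fun a => hv _, ?_⟩
  · rw [← Finset.sum_div] at hpos
    have := (div_pos_iff_of_pos_right (by positivity)).1 hpos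
    exact_mod_cast this
  · convert hn using 2
    rw [hsum, ← Finset.sum_div, inv_div]
    simp only [div_eq_inv_mul, mul_smul, ← Finset.smul_sum]
    rw [smul_inv_smul₀ hn0']
    simp [m]

/-! ### Trace norm estimates and unitary conjugation -/

/-- The squared Frobenius norm is the sum of the squared singular values. -/
theorem sum_eigenvalues_conjTranspose_mul_self {n : ℕ} (A : Op n) :
    ∑ i, (Matrix.isHermitian_conjTranspose_mul_self A).eigenvalues i =
      (A.conjTranspose * A).trace.re := by
  rw [(Matrix.isHermitian_conjTranspose_mul_self A).trace_eq_sum_eigenvalues]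
  simp

/-- Together with `sq_traceNorm_le`, this reduces trace norm estimates to the Frobenius norm, whose
entrywise formula and unitary invariance are immediate. -/
theorem trace_conjTranspose_mul_self_le {n : ℕ} (A : Op n) :
    (A.conjTranspose * A).trace.re ≤ traceNorm A ^ 2 := by
  have h := (Matrix.posSemidef_conjTranspose_mul_self A).eigenvalues_nonneg
  rw [← sum_eigenvalues_conjTranspose_mul_self]
  calc _ = ∑ i, √((Matrix.isHermitian_conjTranspose_mul_self A).eigenvalues i) ^ 2 :=
        Finset.sum_congr rfl fun i _ => (Real.sq_sqrt (h i)).symm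
    _ ≤ _ := Finset.sum_sq_le_sq_sum_of_nonneg fun i _ => Real.sqrt_nonneg _

theorem sq_traceNorm_le {n : ℕ} (A : Op n) :
    traceNorm A ^ 2 ≤ n * (A.conjTranspose * A).trace.re := by
  have h := (Matrix.posSemidef_conjTranspose_mul_self A).eigenvalues_nonneg
  rw [← sum_eigenvalues_conjTranspose_mul_self]
  calc _ ≤ _ := sq_sum_le_card_mul_sum_sq
    _ = _ := by
      simp only [Finset.card_univ, Fintype.card_fin]
      congr 1
      exact Finset.sum_congr rfl fun i _ => Real.sq_sqrt (h i)

theorem traceNorm_nonneg {n : ℕ} (A : Op n) : 0 ≤ traceNorm A :=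
  Finset.sum_nonneg fun _ _ => Real.sqrt_nonneg _

theorem trace_conjTranspose_mul_self_re {n : ℕ} (A : Op n) :
    (A.conjTranspose * A).trace.re = ∑ i, ∑ j, ‖A j i‖ ^ 2 := by
  simp only [Matrix.trace, Matrix.diag_apply, Matrix.mul_apply, Matrix.conjTranspose_apply,
    Complex.re_sum]
  refine Finset.sum_congr rfl fun i _ => Finset.sum_congr rfl fun j _ => ?_
  rw [Complex.star_def, ← Complex.normSq_eq_conj_mul_self, Complex.ofReal_re,
    Complex.normSq_eq_norm_sq]

theorem trace_unitaryMap {n : ℕ} (U : Matrix.unitaryGroup (Fin n) ℂ) (A : Op n) :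
    (unitaryMap U A).trace = A.trace := by
  have hU : (U : Op n).conjTranspose * (U : Op n) = 1 := Matrix.mem_unitaryGroup_iff'.1 U.2
  simp only [unitaryMap, LinearMap.coe_mk, AddHom.coe_mk]
  rw [Matrix.trace_mul_comm, ← mul_assoc, hU, one_mul]

theorem unitaryMap_mul {n : ℕ} (U : Matrix.unitaryGroup (Fin n) ℂ) (A B : Op n) :
    unitaryMap U (A * B) = unitaryMap U A * unitaryMap U B := by
  have hU : (U : Op n).conjTranspose * (U : Op n) = 1 := Matrix.mem_unitaryGroup_iff'.1 U.2
  simp only [unitaryMap, LinearMap.coe_mk, AddHom.coe_mk]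
  calc _ = (U : Op n) * A * 1 * B * (U : Op n).conjTranspose := by simp [mul_assoc]
    _ = _ := by rw [← hU]; simp only [mul_assoc]

theorem unitaryMap_conjTranspose {n : ℕ} (U : Matrix.unitaryGroup (Fin n) ℂ) (A : Op n) :
    (unitaryMap U A).conjTranspose = unitaryMap U A.conjTranspose := by
  simp [unitaryMap, mul_assoc]

theorem unitaryMap_star_apply {n : ℕ} (U : Matrix.unitaryGroup (Fin n) ℂ) (A : Op n) :
    unitaryMap U (unitaryMap (star U) A) = A := by
  have hU : (U : Op n) * (U : Op n).conjTranspose = 1 := Matrix.mem_unitaryGroup_iff.1 U.2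
  have h : ((star U : Matrix.unitaryGroup (Fin n) ℂ) : Op n) = (U : Op n).conjTranspose := rfl
  simp only [unitaryMap, LinearMap.coe_mk, AddHom.coe_mk, h, Matrix.conjTranspose_conjTranspose]
  calc _ = ((U : Op n) * (U : Op n).conjTranspose) * A *
        ((U : Op n) * (U : Op n).conjTranspose) := by simp only [mul_assoc]
    _ = _ := by rw [hU, one_mul, mul_one]

theorem unitaryMap_star_unitaryMap {n : ℕ} (U : Matrix.unitaryGroup (Fin n) ℂ) (A : Op n) :
    unitaryMap (star U) (unitaryMap U A) = A := by
  simpa using unitaryMap_star_apply (star U) A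

theorem trace_conjTranspose_mul_self_unitaryMap {n : ℕ} (U : Matrix.unitaryGroup (Fin n) ℂ)
    (A : Op n) : ((unitaryMap U A).conjTranspose * unitaryMap U A).trace =
      (A.conjTranspose * A).trace := by
  rw [unitaryMap_conjTranspose, ← unitaryMap_mul, trace_unitaryMap]

theorem norm_unitaryMap_apply_le_traceNorm {n : ℕ} (U : Matrix.unitaryGroup (Fin n) ℂ)
    (A : Op n) (i j : Fin n) : ‖unitaryMap U A i j‖ ≤ traceNorm A := by
  refine le_of_sq_le_sq ?_ (traceNorm_nonneg A)
  refine le_trans ?_ (trace_conjTranspose_mul_self_le A)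
  rw [← trace_conjTranspose_mul_self_unitaryMap U, trace_conjTranspose_mul_self_re]
  exact (Finset.single_le_sum (f := fun i => ‖unitaryMap U A i j‖ ^ 2)
    (fun _ _ => by positivity) (Finset.mem_univ i)).trans
      (Finset.single_le_sum (f := fun j => ∑ i, ‖unitaryMap U A i j‖ ^ 2)
        (fun _ _ => by positivity) (Finset.mem_univ j))

theorem traceNorm_unitaryMap_diagonal_le {n : ℕ} (U : Matrix.unitaryGroup (Fin n) ℂ)
    (x : Fin n → ℝ) :
    traceNorm (unitaryMap U (Matrix.diagonal fun i => (x i : ℂ))) ≤ n * ‖x‖ := by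
  refine le_of_sq_le_sq ((sq_traceNorm_le _).trans ?_) (by positivity)
  rw [trace_conjTranspose_mul_self_unitaryMap, Matrix.diagonal_conjTranspose,
    Matrix.diagonal_mul_diagonal, Matrix.trace_diagonal, mul_pow, sq (n : ℝ), mul_assoc]
  gcongr
  rw [Complex.re_sum]
  refine (Finset.sum_le_card_nsmul _ _ (‖x‖ ^ 2) fun i _ => ?_).trans (by simp)
  simp only [Pi.star_apply, RCLike.star_def, Complex.conj_ofReal, ← Complex.ofReal_mul,
    Complex.ofReal_re]
  rw [← sq, ← sq_abs, ← Real.norm_eq_abs]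
  exact pow_le_pow_left₀ (norm_nonneg _) (norm_le_pi_norm x i) 2

/-! ### Invariants of noisy operations -/

theorem IsNoisyOperation.posSemidef {m n : ℕ} {f : Op m →ₗ[ℂ] Op n} (hf : IsNoisyOperation f)
    {A : Op m} (hA : A.PosSemidef) : (f A).PosSemidef := by
  induction hf with
  | @unitary n U => exact hA.mul_mul_conjTranspose_same (B := (U : Op n))
  | @ancilla n N k hN e =>
    have : (maximallyMixed N).PosSemidef := Matrix.PosSemidef.one.smul (by positivity)
    exact (hA.kronecker this).submatrix _
  | @partialTrace n N k hN e =>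
    have h : traceOut e A = ∑ a, A.submatrix (fun i => e (i, a)) fun i => e (i, a) := by
      ext i j
      simp [traceOut, Matrix.sum_apply]
    rw [h]
    exact Matrix.posSemidef_sum _ fun a _ => hA.submatrix _
  | comp _ _ ihg ihf => exact ihg (ihf hA)

theorem IsNoisyOperation.trace {m n : ℕ} {f : Op m →ₗ[ℂ] Op n} (hf : IsNoisyOperation f)
    (A : Op m) : (f A).trace = A.trace := by
  induction hf with
  | unitary U => exact trace_unitaryMap U A
  | @ancilla n N k hN e =>
    have hN' : (N : ℂ) ≠ 0 := by exact_mod_cast hN.ne'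
    have : (addNoise e A).trace = (A ⊗ₖ maximallyMixed N).trace :=
      Equiv.sum_comp e.symm fun x => (A ⊗ₖ maximallyMixed N) x x
    rw [this, Matrix.trace_kronecker]
    simp [maximallyMixed, hN']
  | @partialTrace n N k hN e =>
    simp only [Matrix.trace, Matrix.diag_apply, traceOut, LinearMap.coe_mk, AddHom.coe_mk,
      Matrix.of_apply]
    rw [← Fintype.sum_prod_type' fun i a => A (e (i, a)) (e (i, a))]
    exact Equiv.sum_comp e fun x => A x x
  | comp _ _ ihg ihf => exact (ihg _).trans (ihf A)

/-- Intermediate dimensions vary, so the induction can only keep the identity up to a scalar; trace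
preservation fixes the scalar when the dimensions agree. -/
theorem IsNoisyOperation.exists_apply_one {m n : ℕ} {f : Op m →ₗ[ℂ] Op n}
    (hf : IsNoisyOperation f) : ∃ c : ℂ, f 1 = c • 1 := by
  induction hf with
  | @unitary n U =>
    have hU : (U : Op n) * (U : Op n).conjTranspose = 1 := Matrix.mem_unitaryGroup_iff.1 U.2
    exact ⟨1, by simp [unitaryMap, hU]⟩
  | @ancilla n N k hN e =>
    exact ⟨(N : ℂ)⁻¹, by
      simp only [addNoise, maximallyMixed, LinearMap.coe_mk, AddHom.coe_mk,
        Matrix.kronecker_smul, Matrix.one_kronecker_one, Matrix.reindex_apply]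
      ext i j
      simp [Matrix.one_apply]⟩
  | @partialTrace n N k hN e =>
    refine ⟨N, ?_⟩
    ext i j
    simp [traceOut, Matrix.one_apply]
  | @comp l m n g f _ _ ihg ihf =>
    obtain ⟨c, hc⟩ := ihf
    obtain ⟨c', hc'⟩ := ihg
    exact ⟨c * c', by simp [hc, hc', mul_smul]⟩

theorem IsNoisyOperation.apply_one {d : ℕ} {f : Op d →ₗ[ℂ] Op d} (hf : IsNoisyOperation f) :
    f 1 = 1 := by
  obtain ⟨c, hc⟩ := hf.exists_apply_one
  rcases Nat.eq_zero_or_pos d with rfl | hd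
  · exact Subsingleton.elim _ _
  · have h := hf.trace 1
    have hd' : (d : ℂ) ≠ 0 := by exact_mod_cast hd.ne'
    rw [hc, Matrix.trace_smul, Matrix.trace_one, Fintype.card_fin, smul_eq_mul,
      mul_eq_right₀ hd'] at h
    rw [hc, h, one_smul]

/-! ### Necessity: doubly stochastic matrices -/

theorem DensityMatrix.mat_eq_unitaryMap {d : ℕ} (ρ : DensityMatrix d) :
    ρ.mat = unitaryMap ρ.posSemidef.isHermitian.eigenvectorUnitary
      (Matrix.diagonal fun i => (ρ.posSemidef.isHermitian.eigenvalues i : ℂ)) :=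
  ρ.posSemidef.isHermitian.spectral_theorem

theorem DensityMatrix.sum_eigenvalues₀ {d : ℕ} (ρ : DensityMatrix d) :
    ∑ i, ρ.posSemidef.isHermitian.eigenvalues₀ i = 1 := by
  have h := ρ.posSemidef.isHermitian.trace_eq_sum_eigenvalues
  rw [ρ.trace_eq_one] at h
  have h' : ∑ i, ρ.posSemidef.isHermitian.eigenvalues i = 1 := by
    simpa using (congrArg Complex.re h).symm
  exact (Equiv.sum_comp _ _).symm.trans h'

/-- The column sums of `T` over its first `k` rows are weights in `[0, 1]` of total `k`. -/
theorem sum_filter_mulVec_le_of_mem_doublyStochastic {n k : ℕ} {T : Matrix (Fin n) (Fin n) ℝ}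
    (hT : T ∈ doublyStochastic ℝ (Fin n)) {p : Fin n → ℝ} (hp : Antitone p) (hk : k ≤ n) :
    ∑ i with i.val < k, (T.mulVec p) i ≤ ∑ i with i.val < k, p i := by
  obtain ⟨h0, hr, hc⟩ := mem_doublyStochastic_iff_sum.1 hT
  have h := sum_mul_le_sum_filter_val_lt (t := fun j => ∑ i with i.val < k, T i j) hp hk
    (fun j => Finset.sum_nonneg fun i _ => h0 i j)
    (fun j => (Finset.sum_le_sum_of_subset_of_nonneg (Finset.subset_univ _)
      fun i _ _ => h0 i j).trans_eq (hc j))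
    (by rw [Finset.sum_comm]; simp [hr, Fin.card_filter_val_lt, hk])
  convert h using 1
  simp only [Matrix.mulVec, dotProduct, Finset.mul_sum]
  rw [Finset.sum_comm]
  exact Finset.sum_congr rfl fun j _ => Finset.sum_congr rfl fun i _ => mul_comm _ _

/-- The diagonal part of a noisy operation. -/
noncomputable def transitionMatrix {d : ℕ} (f : Op d →ₗ[ℂ] Op d) : Matrix (Fin d) (Fin d) ℝ :=
  Matrix.of fun i j => (f (Matrix.single j j 1) i i).re

theorem transitionMatrix_mulVec {d : ℕ} (f : Op d →ₗ[ℂ] Op d) (p : Fin d → ℝ) (i : Fin d) :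
    (transitionMatrix f).mulVec p i = (f (Matrix.diagonal fun j => (p j : ℂ)) i i).re := by
  have h : (Matrix.diagonal fun j => (p j : ℂ)) = ∑ j, (p j : ℂ) • Matrix.single j j (1 : ℂ) := by
    ext a b
    simp [Matrix.sum_apply, Matrix.single_apply, Matrix.diagonal_apply, ite_and]
  rw [h, map_sum, Matrix.sum_apply, Complex.re_sum]
  simp only [Matrix.mulVec, dotProduct]
  refine Finset.sum_congr rfl fun j _ => ?_
  rw [map_smul, Matrix.smul_apply, smul_eq_mul, Complex.re_ofReal_mul, mul_comm]
  rfl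

/-- Positivity gives nonnegative entries, unitality the row sums, trace preservation the column
sums. -/
theorem IsNoisyOperation.transitionMatrix_mem_doublyStochastic {d : ℕ} {f : Op d →ₗ[ℂ] Op d}
    (hf : IsNoisyOperation f) : transitionMatrix f ∈ doublyStochastic ℝ (Fin d) := by
  refine mem_doublyStochastic.2 ⟨fun i j => ?_, ?_, ?_⟩
  · have h : (Matrix.single j j (1 : ℂ)).PosSemidef := by
      rw [← Matrix.diagonal_single]
      exact Matrix.PosSemidef.diagonal (Pi.single_nonneg.2 zero_le_one)
    exact (Complex.nonneg_iff.1 (hf.posSemidef h).diag_nonneg).1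
  · ext i
    rw [transitionMatrix_mulVec]
    simp [hf.apply_one]
  · ext j
    have h := congrArg Complex.re (hf.trace (Matrix.single j j 1))
    simpa [Matrix.trace, Matrix.vecMul, dotProduct, transitionMatrix, Matrix.single_apply] using h

theorem NoisyTransition.moreMixed {d : ℕ} {ρ σ : DensityMatrix d} (h : NoisyTransition ρ σ) :
    MoreMixed σ ρ := by
  intro k hk
  refine le_of_forall_pos_le_add fun ε hε => ?_
  -- Each of the `k ≤ d` diagonal entries is off by at most this amount; `d + 1` avoids dividing by
  -- zero when `d = 0`.
  obtain ⟨Λ, hΛ, hd⟩ := h (ε / (d + 1)) (by positivity)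
  set p := ρ.posSemidef.isHermitian.eigenvalues
  set q := σ.posSemidef.isHermitian.eigenvalues
  set U := ρ.posSemidef.isHermitian.eigenvectorUnitary
  set V := σ.posSemidef.isHermitian.eigenvectorUnitary
  -- The relabelling must be the one by which `eigenvalues` is defined from `eigenvalues₀`.
  let e : Fin (Fintype.card (Fin d)) ≃ Fin d := Fintype.equivOfCardEq (Fintype.card_fin _)
  let T := transitionMatrix (unitaryMap (star V) ∘ₗ Λ ∘ₗ unitaryMap U)
  have hT : T ∈ doublyStochastic ℝ (Fin d) :=
    (IsNoisyOperation.comp (.unitary _) (.comp hΛ (.unitary _))).transitionMatrix_mem_doublyStochastic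
  have hT' : T.submatrix e e ∈ doublyStochastic ℝ (Fin (Fintype.card (Fin d))) := by
    obtain ⟨h0, hr, hc⟩ := mem_doublyStochastic_iff_sum.1 hT
    exact mem_doublyStochastic_iff_sum.2 ⟨fun i j => h0 _ _,
      fun i => (Equiv.sum_comp e fun j => T (e i) j).trans (hr _),
      fun j => (Equiv.sum_comp e fun i => T i (e j)).trans (hc _)⟩
  have hq : ∀ i, q i ≤ T.mulVec p i + ε / (d + 1) := fun i => by
    have h1 := (norm_unitaryMap_apply_le_traceNorm (star V) (Λ ρ.mat - σ.mat) i i).trans hd.le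
    have h2 : unitaryMap (star V) σ.mat i i = (q i : ℂ) := by
      rw [σ.mat_eq_unitaryMap, unitaryMap_star_unitaryMap, Matrix.diagonal_apply_eq]
    have h3 : T.mulVec p i = (unitaryMap (star V) (Λ ρ.mat) i i).re := by
      rw [transitionMatrix_mulVec, ρ.mat_eq_unitaryMap]
      rfl
    have h4 := (Complex.abs_re_le_norm _).trans h1
    rw [map_sub, Matrix.sub_apply, h2, Complex.sub_re, ← h3, Complex.ofReal_re] at h4
    linarith [(abs_le.1 h4).1]
  have hp0 : ∀ j, ρ.posSemidef.isHermitian.eigenvalues₀ j = p (e j) := fun j => by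
    simp [p, e, Matrix.IsHermitian.eigenvalues]
  have hq0 : ∀ j, σ.posSemidef.isHermitian.eigenvalues₀ j = q (e j) := fun j => by
    simp [q, e, Matrix.IsHermitian.eigenvalues]
  have hmul : ∀ i, (T.submatrix e e).mulVec ρ.posSemidef.isHermitian.eigenvalues₀ i =
      T.mulVec p (e i) := fun i => by
    simp only [Matrix.mulVec, dotProduct, Matrix.submatrix_apply, hp0]
    exact Equiv.sum_comp e fun j => T (e i) j * p j
  have hmain := sum_filter_mulVec_le_of_mem_doublyStochastic hT'
    ρ.posSemidef.isHermitian.eigenvalues₀_antitone (hk.trans_eq (Fintype.card_fin d).symm)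
  calc σ.sumLargest k ≤ ∑ i : Fin (Fintype.card (Fin d)) with i.val < k,
        ((T.submatrix e e).mulVec ρ.posSemidef.isHermitian.eigenvalues₀ i + ε / (d + 1)) :=
        Finset.sum_le_sum fun i _ => by rw [hq0, hmul]; exact hq _
    _ ≤ ρ.sumLargest k + k * (ε / (d + 1)) := by
        rw [Finset.sum_add_distrib]
        gcongr
        · exact hmain
        · simp [Fin.card_filter_val_lt, hk]
    _ ≤ ρ.sumLargest k + ε := by
        have : (k : ℝ) ≤ d + 1 := by exact_mod_cast hk.trans d.le_succ
        gcongr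
        rw [mul_div_assoc', div_le_iff₀ (by positivity), mul_comm ε]
        gcongr

/-! ### Sufficiency: ancilla-controlled permutations -/

/-- Permutation matrices as unitaries. -/
noncomputable def permUnitary {n : ℕ} (π : Equiv.Perm (Fin n)) : Matrix.unitaryGroup (Fin n) ℂ :=
  ⟨(1 : Op n).submatrix π id, Matrix.mem_unitaryGroup_iff.2 (by
    ext i j
    simp [Matrix.mul_apply, Matrix.one_apply, Matrix.star_apply])⟩

theorem unitaryMap_permUnitary {n : ℕ} (π : Equiv.Perm (Fin n)) (A : Op n) :
    unitaryMap (permUnitary π) A = A.submatrix π π := by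
  ext i j
  simp [unitaryMap, permUnitary, Matrix.mul_apply, Matrix.one_apply]

/-- Uniform mixtures of permutations of the diagonal can be implemented by noisy operations. -/
theorem exists_isNoisyOperation_diagonal {d N : ℕ} (hN : 0 < N) (g : Fin N → Equiv.Perm (Fin d)) :
    ∃ Λ : Op d →ₗ[ℂ] Op d, IsNoisyOperation Λ ∧ ∀ x : Fin d → ℂ,
      Λ (Matrix.diagonal x) = Matrix.diagonal fun i => (N : ℂ)⁻¹ * ∑ a, x (g a i) := by
  let e : Fin d × Fin N ≃ Fin (d * N) := finProdFinEquiv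
  -- The controlled permutation `(i, a) ↦ (g a i, a)`: tracing out the uniformly distributed label
  -- `a` averages over `g`.
  let π : Equiv.Perm (Fin (d * N)) := e.permCongr (Equiv.prodCongrLeft g)
  refine ⟨traceOut e ∘ₗ unitaryMap (permUnitary π) ∘ₗ addNoise e,
    .comp (.partialTrace hN e) (.comp (.unitary _) (.ancilla hN e)), fun x => ?_⟩
  ext i j
  have hπ : ∀ i a, e.symm (π (e (i, a))) = (g a i, a) := fun i a => by
    simp [π, Equiv.permCongr_apply]
  simp only [LinearMap.comp_apply, unitaryMap_permUnitary]
  simp only [traceOut, addNoise, LinearMap.coe_mk, AddHom.coe_mk, Matrix.of_apply,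
    Matrix.submatrix_apply, Matrix.reindex_apply, hπ, Matrix.kroneckerMap_apply]
  by_cases hij : i = j
  · subst hij
    simp [maximallyMixed, Finset.mul_sum, mul_comm]
  · simp [hij]

theorem MoreMixed.noisyTransition {d : ℕ} {ρ σ : DensityMatrix d} (h : MoreMixed σ ρ) :
    NoisyTransition ρ σ := by
  intro ε hε
  let U := ρ.posSemidef.isHermitian.eigenvectorUnitary
  let V := σ.posSemidef.isHermitian.eigenvectorUnitary
  let e : Fin (Fintype.card (Fin d)) ≃ Fin d := Fintype.equivOfCardEq (Fintype.card_fin _)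
  obtain ⟨N, hN, g, hg, hdist⟩ := exists_dist_average_lt
    (mem_convexHull_range_comp_perm σ.posSemidef.isHermitian.eigenvalues₀_antitone
      (fun k hk => h k (hk.trans_eq (Fintype.card_fin d)))
      (σ.sum_eigenvalues₀.trans ρ.sum_eigenvalues₀.symm)) (ε := ε / (d + 1)) (by positivity)
  choose π hπ using hg
  obtain ⟨Λ, hΛ, hdiag⟩ := exists_isNoisyOperation_diagonal hN fun a => e.permCongr (π a)
  refine ⟨unitaryMap V ∘ₗ Λ ∘ₗ unitaryMap (star U),
    .comp (.unitary _) (.comp hΛ (.unitary _)), ?_⟩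
  set x : Fin (Fintype.card (Fin d)) → ℝ :=
    (N : ℝ)⁻¹ • ∑ a, g a - σ.posSemidef.isHermitian.eigenvalues₀
  have hx : (unitaryMap V ∘ₗ Λ ∘ₗ unitaryMap (star U)) ρ.mat - σ.mat =
      unitaryMap V (Matrix.diagonal fun i => ((x ∘ e.symm) i : ℂ)) := by
    rw [LinearMap.comp_apply, LinearMap.comp_apply]
    conv_lhs => rw [ρ.mat_eq_unitaryMap, σ.mat_eq_unitaryMap]
    rw [unitaryMap_star_unitaryMap, hdiag, ← map_sub, Matrix.diagonal_sub]
    congr 2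
    ext i
    simp [x, ← hπ, Matrix.IsHermitian.eigenvalues, Equiv.permCongr_apply, e]
  rw [hx]
  refine (traceNorm_unitaryMap_diagonal_le V (x ∘ e.symm)).trans_lt ?_
  have hn : ‖x ∘ e.symm‖ ≤ ‖x‖ :=
    (pi_norm_le_iff_of_nonneg (norm_nonneg x)).2 fun i => norm_le_pi_norm x _
  rw [dist_eq_norm] at hdist
  calc d * ‖x ∘ e.symm‖ ≤ (d + 1) * ‖x‖ := by gcongr; linarith
    _ < (d + 1) * (ε / (d + 1)) := by gcongr
    _ = ε := by field_simp

theorem proposition1 {d : ℕ} (ρ σ : DensityMatrix d) :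
    NoisyTransition ρ σ ↔ MoreMixed σ ρ :=
  ⟨NoisyTransition.moreMixed, MoreMixed.noisyTransition⟩
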